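/- Let $R$ be a commutative Noetherian local ring of Krull dimension at least two, and let $M$ be a nonzero finitely generated $R$-module. Assume that $M$ is maximal Cohen–Macaulay, i.e. $\operatorname{depth}_R M=\dim M=\dim R$, and that $M$ is Tor-rigid, i.e. whenever $\operatorname{Tor}^R_n(M,N)=0$ for some finitely generated $R$-module $N$ and some integer $n\ge 0$, one has $\operatorname{Tor}^R_j(M,N)=0$ for all $j\ge n$. Then $\operatorname{Supp}_R(M)$ contains every prime ideal of $R$ of height two. -/

import Mathlib

/-!
Depth, maximal Cohen-Macaulay modules and Tor-rigid modules over a local ring.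
The definitions are meant for finitely generated modules over a Noetherian local ring.
-/

universe u

/-- The depth of a finitely generated module `M` over a Noetherian local ring `R`: the supremum of
the lengths of the `M`-regular sequences contained in the maximal ideal.

The condition `M ≠ (r₁, …, rₙ) M` is automatic (Nakayama) for a nonzero finitely generated `M` and
elements of the maximal ideal, so weakly regular sequences are used; with them the zero module
has depth `∞`, which is the usual convention. -/
noncomputable def moduleDepth (R : Type u) [CommRing R] [IsLocalRing R]
    (M : Type u) [AddCommGroup M] [Module R M] : ℕ∞ :=
  ⨆ (rs : List R) (_ : ∀ r ∈ rs, r ∈ IsLocalRing.maximalIdeal R)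
    (_ : RingTheory.Sequence.IsWeaklyRegular M rs), (rs.length : ℕ∞)

/-- A finitely generated module `M` over a Noetherian local ring `R` is maximal Cohen-Macaulay if
`depth M = dim M = dim R`. -/
structure IsMaximalCohenMacaulay (R : Type u) [CommRing R] [IsLocalRing R]
    (M : Type u) [AddCommGroup M] [Module R M] : Prop where
  depth_eq_dim : (moduleDepth R M : WithBot ℕ∞) = Module.supportDim R M
  dim_eq_dim_ring : Module.supportDim R M = ringKrullDim R

/-- The `R`-module `M` is Tor-rigid: for every finitely generated `R`-module `N` and every
`n ≥ 0`, if `Tor_n(M, N) = 0` then `Tor_j(M, N) = 0` for all `j ≥ n`. -/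
def IsTorRigid (R : Type u) [CommRing R] (M : Type u) [AddCommGroup M] [Module R M] : Prop :=
  ∀ (N : Type u) [AddCommGroup N] [Module R N] [Module.Finite R N] (n : ℕ),
    CategoryTheory.Limits.IsZero
      (((CategoryTheory.Tor (ModuleCat.{u} R) n).obj (ModuleCat.of R M)).obj
        (ModuleCat.of R N)) →
    ∀ j : ℕ, n ≤ j →
      CategoryTheory.Limits.IsZero
        (((CategoryTheory.Tor (ModuleCat.{u} R) j).obj (ModuleCat.of R M)).obj
          (ModuleCat.of R N))

/-! The support is all of `Spec R`; it suffices to catch each minimal prime `q`. Rigidity applied to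
`R/xR` shows that `M`-regular elements are `R`-regular (`isSMulRegular_of_isTorRigid`). Since `q`
consists of zero divisors of `R`, prime avoidance puts it inside an associated prime `P` of `M`. If
`q ∉ Supp M`, then `q < P`, so `dim R/P < dim R/q ≤ dim R = depth M`, against `depth M ≤ dim R/P`
(`moduleDepth_le_coheight_of_isAssociatedPrime`). -/

open CategoryTheory CategoryTheory.Limits

namespace CategoryTheory.ProjectiveResolution

variable {C : Type*} [Category* C] [Abelian C]

section OfPresentation

variable [EnoughProjectives C] {P₁ P₀ : C} (f : P₁ ⟶ P₀)

/-- The complex obtained by extending a morphism `P₁ ⟶ P₀` to the left by projective objects. -/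
noncomputable def complexOfPresentation : ChainComplex C ℕ :=
  ChainComplex.mk' P₀ P₁ f
    (fun g => ⟨Projective.over (kernel g), Projective.π (kernel g) ≫ kernel.ι g, by simp⟩)

/-- The object in degree zero of `complexOfPresentation f` is the target of `f`. -/
noncomputable def complexOfPresentationXZero : (complexOfPresentation f).X 0 ≅ P₀ := Iso.refl _

/-- The object in degree one of `complexOfPresentation f` is the source of `f`. -/
noncomputable def complexOfPresentationXOne : (complexOfPresentation f).X 1 ≅ P₁ := Iso.refl _

lemma complexOfPresentation_d_one_zero : (complexOfPresentation f).d 1 0 ≫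
    (complexOfPresentationXZero f).hom = (complexOfPresentationXOne f).hom ≫ f := by
  have h : (complexOfPresentation f).d 1 0 = f := ChainComplex.mk'_d_1_0 ..
  rw [h]
  exact (Category.comp_id f).trans (Category.id_comp f).symm

lemma complexOfPresentation_exactAt_succ (n : ℕ) :
    (complexOfPresentation f).ExactAt (n + 1) := by
  rw [HomologicalComplex.exactAt_iff' _ (n + 1 + 1) (n + 1) n (by simp) (by simp)]
  rw [ShortComplex.exact_iff_epi_kernel_lift]
  let e : (complexOfPresentation f).X (n + 2) ≅
    Projective.over (kernel ((complexOfPresentation f).d (n + 1) n)) := ChainComplex.mk'XIso ..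
  have hd : (complexOfPresentation f).d (n + 2) (n + 1) =
      e.hom ≫ Projective.π _ ≫ kernel.ι _ := ChainComplex.mk'_d ..
  have hlift : kernel.lift ((complexOfPresentation f).d (n + 1) n)
      ((complexOfPresentation f).d (n + 2) (n + 1))
      ((complexOfPresentation f).d_comp_d _ _ _) = e.hom ≫ Projective.π _ := by
    rw [← cancel_mono (kernel.ι _), kernel.lift_ι, hd, Category.assoc]
  have : Epi (e.hom ≫ Projective.π (kernel ((complexOfPresentation f).d (n + 1) n))) :=
    inferInstance
  rwa [← hlift] at this

instance [Projective P₀] [Projective P₁] (n : ℕ) :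
    Projective ((complexOfPresentation f).X n) := by
  obtain (_ | _ | _ | n) := n
  · assumption
  · assumption
  all_goals apply Projective.projective_over

/-- The projective resolution that extends a projective presentation `P₁ ⟶ P₀ ⟶ Z`. -/
noncomputable def ofPresentation [Projective P₀] [Projective P₁] {Z : C} (g : P₀ ⟶ Z) [Epi g]
    (w : f ≫ g = 0) (hfg : (ShortComplex.mk f g w).Exact) : ProjectiveResolution Z where
  complex := complexOfPresentation f
  π := (ChainComplex.toSingle₀Equiv _ _).symm ⟨(complexOfPresentationXZero f).hom ≫ g, by
    rw [← Category.assoc, complexOfPresentation_d_one_zero, Category.assoc, w, comp_zero]⟩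
  quasiIso := ⟨fun n => by
    cases n
    · rw [ChainComplex.quasiIsoAt₀_iff, ShortComplex.quasiIso_iff_of_zeros']
      · refine (ShortComplex.exact_and_epi_g_iff_of_iso ?_).2 ⟨hfg, ‹Epi g›⟩
        exact ShortComplex.isoMk (complexOfPresentationXOne f) (complexOfPresentationXZero f)
          (Iso.refl Z) (complexOfPresentation_d_one_zero f).symm
          (by simp; exact (Category.comp_id _).symm)
      all_goals rfl
    · rw [quasiIsoAt_iff_exactAt']
      · apply complexOfPresentation_exactAt_succ
      · apply ChainComplex.exactAt_succ_single_obj⟩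

end OfPresentation

/-! ### Vanishing of the first two left derived functors -/

section LeftDerived

variable {D : Type*} [Category* D] [Abelian D] {X : C}
  (P : ProjectiveResolution X) (F : C ⥤ D) [F.Additive]

lemma isZero_leftDerived_obj_succ_iff [HasProjectiveResolutions C] (n : ℕ) :
    IsZero ((F.leftDerived (n + 1)).obj X) ↔
      ((ShortComplex.mk (P.complex.d (n + 2) (n + 1)) (P.complex.d (n + 1) n)
        (P.complex.d_comp_d _ _ _)).map F).Exact := by
  rw [(P.isoLeftDerivedObj F (n + 1)).isZero_iff]
  refine (HomologicalComplex.exactAt_iff_isZero_homology _ _).symm.trans ?_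
  rw [HomologicalComplex.exactAt_iff' _ (n + 2) (n + 1) n (by simp) (by simp)]
  rfl

variable [Mono (F.map (P.complex.d 1 0))]

include P in
lemma map_d_two_one_eq_zero_of_mono : F.map (P.complex.d 2 1) = 0 := by
  rw [← cancel_mono (F.map (P.complex.d 1 0)), ← F.map_comp]
  simp

include P in
lemma isZero_leftDerived_obj_one_of_mono [HasProjectiveResolutions C] :
    IsZero ((F.leftDerived 1).obj X) := by
  rw [P.isZero_leftDerived_obj_succ_iff F 0, ShortComplex.exact_iff_mono]
  · assumption
  · exact P.map_d_two_one_eq_zero_of_mono F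

/-- As `F(d₂) = 0`, vanishing in degree 2 makes `F(d₃)` epi. The epi `F(P₂) ⟶ F(ker d₁)` kills
`F(d₃)`, so it is zero. -/
lemma isZero_obj_kernel_of_isZero_leftDerived_obj_two
    [HasProjectiveResolutions C] [F.PreservesEpimorphisms]
    (h : IsZero ((F.leftDerived 2).obj X)) : IsZero (F.obj (kernel (P.complex.d 1 0))) := by
  rw [P.isZero_leftDerived_obj_succ_iff F 1, ShortComplex.exact_iff_epi _
    (P.map_d_two_one_eq_zero_of_mono F)] at h
  let e : P.complex.X 2 ⟶ kernel (P.complex.d 1 0) :=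
    kernel.lift _ (P.complex.d 2 1) (P.complex.d_comp_d _ _ _)
  have : Epi e := (P.exact_succ 0).epi_kernelLift
  have : Epi (F.map (P.complex.d 3 2)) := h
  have hde : P.complex.d 3 2 ≫ e = 0 := by
    rw [← cancel_mono (kernel.ι _)]
    simp [e]
  have he : F.map e = 0 := by
    rw [← cancel_epi (F.map (P.complex.d 3 2)), ← F.map_comp, hde]
    simp
  exact IsZero.of_epi_eq_zero _ he

end LeftDerived

end CategoryTheory.ProjectiveResolution
open IsLocalRing TensorProduct Pointwise

/-! ### Depth and associated primes -/

/-- Let `N ≠ 0` be the elements killed by `P`. If `N ⊆ xM`, cancelling `x` gives `N = xN`,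
contradicting Nakayama. So some `n ∈ N` has nonzero class in `M/xM`, killed by `P` and by `x ∉ P`.
-/
lemma exists_isAssociatedPrime_quotSMulTop_gt {R M : Type*} [CommRing R] [IsLocalRing R]
    [IsNoetherianRing R] [AddCommGroup M] [Module R M] [Module.Finite R M] {x : R}
    (hx : x ∈ maximalIdeal R) (hreg : IsSMulRegular M x) {P : Ideal R}
    (hP : IsAssociatedPrime P M) :
    ∃ Q : Ideal R, IsAssociatedPrime Q (QuotSMulTop x M) ∧ P < Q := by
  obtain ⟨hprime, m, hm⟩ := isAssociatedPrime_iff.mp hP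
  let N : Submodule R M := Submodule.torsionBySet R M P
  have hmN : m ∈ N := by
    refine (Submodule.mem_torsionBySet_iff _ _).mpr fun a => ?_
    simpa [Submodule.mem_colon_singleton] using hm.le a.2
  have hm0 : m ≠ 0 := by
    rintro rfl
    exact hprime.ne_top (by rw [hm]; ext; simp [Submodule.mem_colon_singleton])
  obtain ⟨n, hnN, hn⟩ : ∃ n ∈ N, n ∉ x • (⊤ : Submodule R M) := by
    by_contra! h
    have hle : N ≤ maximalIdeal R • N := by
      intro n hn
      obtain ⟨y, -, rfl⟩ := Submodule.mem_smul_pointwise_iff_exists _ _ _ |>.mp (h n hn)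
      refine Submodule.smul_mem_smul hx ?_
      refine (Submodule.mem_torsionBySet_iff _ _).mpr fun a => hreg ?_
      have := (Submodule.mem_torsionBySet_iff _ _).mp hn a
      simpa [smul_comm x] using this
    have hbot : N = ⊥ := Submodule.eq_bot_of_le_smul_of_le_jacobson_bot _ _
      (IsNoetherian.noetherian N) hle (maximalIdeal_le_jacobson _)
    exact hm0 (by simpa [hbot] using hmN)
  have hne : (Submodule.Quotient.mk n : QuotSMulTop x M) ≠ 0 := by
    rwa [Ne, Submodule.Quotient.mk_eq_zero]
  obtain ⟨Q, hQ, hle⟩ := exists_le_isAssociatedPrime_of_isNoetherianRing R _ hne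
  have hann {a : R} (ha : a • n ∈ x • (⊤ : Submodule R M)) : a ∈ Q := by
    refine hle ?_
    rw [Submodule.mem_colon_singleton, Submodule.mem_bot, ← Submodule.Quotient.mk_smul,
      Submodule.Quotient.mk_eq_zero]
    exact ha
  have hxQ : x ∈ Q := hann (Submodule.smul_mem_pointwise_smul _ _ _ trivial)
  have hxP : x ∉ P := fun h => hm0 <| hreg <| by
    rw [hm, Submodule.mem_colon_singleton] at h
    simpa using h
  refine ⟨Q, hQ, lt_of_le_of_ne (fun a ha => hann ?_) fun h => hxP (h ▸ hxQ)⟩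
  have := (Submodule.mem_torsionBySet_iff _ _).mp hnN ⟨a, ha⟩
  simp only at this
  rw [this]
  exact zero_mem _

lemma length_le_coheight_of_isAssociatedPrime {R : Type*} [CommRing R] [IsLocalRing R]
    [IsNoetherianRing R] (rs : List R) (hrs : ∀ r ∈ rs, r ∈ maximalIdeal R) :
    ∀ {M : Type*} [AddCommGroup M] [Module R M] [Module.Finite R M]
      (_ : RingTheory.Sequence.IsWeaklyRegular M rs) (P : PrimeSpectrum R)
      (_ : IsAssociatedPrime P.asIdeal M), (rs.length : ℕ∞) ≤ Order.coheight P := by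
  induction rs with
  | nil => simp
  | cons x rs ih =>
    intro M _ _ _ hreg P hP
    rw [RingTheory.Sequence.isWeaklyRegular_cons_iff] at hreg
    obtain ⟨Q, hQ, hlt⟩ :=
      exists_isAssociatedPrime_quotSMulTop_gt (hrs x (by simp)) hreg.1 hP
    have := ih (fun r hr => hrs r (by simp [hr])) hreg.2 ⟨Q, hQ.1⟩ hQ
    calc ((x :: rs).length : ℕ∞) = rs.length + 1 := by simp
      _ ≤ Order.coheight (⟨Q, hQ.1⟩ : PrimeSpectrum R) + 1 := by gcongr
      _ ≤ Order.coheight P := Order.coheight_add_one_le hlt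

lemma moduleDepth_le_coheight_of_isAssociatedPrime {R : Type u} [CommRing R] [IsLocalRing R]
    [IsNoetherianRing R] {M : Type u} [AddCommGroup M] [Module R M] [Module.Finite R M]
    (P : PrimeSpectrum R) (hP : IsAssociatedPrime P.asIdeal M) :
    moduleDepth R M ≤ Order.coheight P :=
  iSup_le fun rs => iSup_le fun hrs => iSup_le fun hreg =>
    length_le_coheight_of_isAssociatedPrime rs hrs hreg P hP

lemma exists_surjective_residueField (R M : Type*) [CommRing R] [IsLocalRing R]
    [AddCommGroup M] [Module R M] [Module.Finite R M] [Nontrivial M] :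
    ∃ f : M →ₗ[R] ResidueField R, Function.Surjective f := by
  have : Nontrivial (ResidueField R ⊗[R] M) := by
    rw [← not_subsingleton_iff_nontrivial, IsLocalRing.subsingleton_tensorProduct,
      not_subsingleton_iff_nontrivial]
    infer_instance
  obtain ⟨v, hv⟩ := exists_ne (0 : ResidueField R ⊗[R] M)
  obtain ⟨φ, hφ⟩ : ∃ φ : Module.Dual (ResidueField R) (ResidueField R ⊗[R] M), φ v ≠ 0 := by
    by_contra! h
    exact hv ((Module.forall_dual_apply_eq_zero_iff _ _).mp h)
  refine ⟨φ.restrictScalars R ∘ₗ TensorProduct.mk R (ResidueField R) M 1,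
    (LinearMap.surjective fun h => hφ (by simp [h])).comp
      (TensorProduct.mk_surjective R M _ Ideal.Quotient.mk_surjective)⟩

lemma subsingleton_right_of_subsingleton_tensorProduct (R M N : Type*) [CommRing R] [IsLocalRing R]
    [AddCommGroup M] [Module R M] [Module.Finite R M] [AddCommGroup N] [Module R N]
    [Module.Finite R N] [Nontrivial M] [Subsingleton (M ⊗[R] N)] : Subsingleton N := by
  obtain ⟨f, hf⟩ := exists_surjective_residueField R M
  rw [← IsLocalRing.subsingleton_tensorProduct (R := R)]
  exact (LinearMap.rTensor_surjective N hf).subsingleton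
-- Rigidity and the support
-- Resolve `R/xR` starting with `x : R → R`. Regularity on `M` gives `Tor₁ = 0`, rigidity gives
-- `Tor₂ = 0`, hence `M ⊗ (0 : x) = 0`, and Nakayama gives `(0 : x) = 0`.
lemma isSMulRegular_of_isTorRigid {R : Type u} [CommRing R] [IsLocalRing R]
    [IsNoetherianRing R] {M : Type u} [AddCommGroup M] [Module R M] [Module.Finite R M]
    [Nontrivial M] (hrigid : IsTorRigid R M) {x : R}
    (hreg : IsSMulRegular M x) : IsSMulRegular R x := by
  let f : ModuleCat.of R R ⟶ ModuleCat.of R R := ModuleCat.ofHom (LinearMap.lsmul R R x)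
  let F := (MonoidalCategory.tensoringLeft (ModuleCat.{u} R)).obj (ModuleCat.of R M)
  have : Projective (ModuleCat.of R R) := inferInstance
  have : Module.Finite R (cokernel f : ModuleCat.{u} R) :=
    Module.Finite.of_surjective (cokernel.π f).hom
      ((ModuleCat.epi_iff_surjective _).mp inferInstance)
  let P : ProjectiveResolution (cokernel f) := .ofPresentation f (cokernel.π f)
    (cokernel.condition f) (ShortComplex.exact_cokernel f)
  let e₀ : P.complex.X 0 ≅ ModuleCat.of R R := ProjectiveResolution.complexOfPresentationXZero f
  let e₁ : P.complex.X 1 ≅ ModuleCat.of R R := ProjectiveResolution.complexOfPresentationXOne f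
  have hd : P.complex.d 1 0 ≫ e₀.hom = e₁.hom ≫ f :=
    ProjectiveResolution.complexOfPresentation_d_one_zero f
  have : Mono (F.map f) := by
    refine (ModuleCat.mono_iff_injective _).mpr ?_
    change Function.Injective (LinearMap.lTensor M (LinearMap.lsmul R R x))
    have h : TensorProduct.rid R M ∘ LinearMap.lTensor M (LinearMap.lsmul R R x) =
        (x • ·) ∘ TensorProduct.rid R M := by
      have : (TensorProduct.rid R M).toLinearMap ∘ₗ LinearMap.lTensor M (LinearMap.lsmul R R x) =
          LinearMap.lsmul R M x ∘ₗ (TensorProduct.rid R M).toLinearMap := by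
        ext; simp
      exact congrArg DFunLike.coe this
    refine Function.Injective.of_comp (f := TensorProduct.rid R M) ?_
    rw [h]
    exact Function.Injective.comp hreg (TensorProduct.rid R M).injective
  have : Mono (F.map (P.complex.d 1 0)) := by
    rw [← Iso.eq_comp_inv] at hd
    rw [hd, F.map_comp, F.map_comp]
    infer_instance
  have : F.PreservesEpimorphisms := inferInstance
  have h2 := hrigid (cokernel f : ModuleCat.{u} R) 1
    (P.isZero_leftDerived_obj_one_of_mono F) 2 (by simp)
  have h0 := P.isZero_obj_kernel_of_isZero_leftDerived_obj_two F h2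
  let K := kernel (P.complex.d 1 0)
  have : Subsingleton (M ⊗[R] K) := ModuleCat.subsingleton_of_isZero h0
  have : Module.Finite R K :=
    Module.Finite.of_injective (kernel.ι (P.complex.d 1 0) ≫ e₁.hom).hom
      ((ModuleCat.mono_iff_injective _).mp inferInstance)
  have := subsingleton_right_of_subsingleton_tensorProduct R M K
  have : Mono (P.complex.d 1 0) := Preadditive.mono_of_kernel_zero
    ((ModuleCat.isZero_of_subsingleton K).eq_zero_of_src _)
  have hf : Mono f := by
    rw [← Iso.inv_comp_eq] at hd
    rw [← hd]
    infer_instance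
  exact (ModuleCat.mono_iff_injective f).mp hf

theorem support_eq_univ_of_isTorRigid {R : Type u} [CommRing R] [IsLocalRing R]
    [IsNoetherianRing R] {M : Type u} [AddCommGroup M] [Module R M] [Module.Finite R M]
    [Nontrivial M] (hMCM : IsMaximalCohenMacaulay R M) (hrigid : IsTorRigid R M) :
    Module.support R M = Set.univ := by
  refine Set.eq_univ_of_forall fun p => ?_
  obtain ⟨q, hq, hqp⟩ := Ideal.exists_minimalPrimes_le (I := (⊥ : Ideal R)) (J := p.asIdeal) bot_le
  let q' : PrimeSpectrum R := ⟨q, hq.1.1⟩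
  suffices q' ∈ Module.support R M from Module.mem_support_mono hqp this
  by_contra hsupp
  have hsub : (q : Set R) ⊆ ⋃ P ∈ associatedPrimes R M, P := by
    rw [biUnion_associatedPrimes_eq_compl_regular R M]
    intro x hx hreg
    have h := isSMulRegular_of_isTorRigid hrigid hreg
    exact notMem_nonZeroDivisors_of_mem_mem_minimalPrimes hx hq
      (mem_nonZeroDivisors_iff_right.mpr fun y hy => h (by simpa [mul_comm] using hy))
  obtain ⟨P, hP, hle⟩ := (Ideal.subset_union_prime_finite (associatedPrimes.finite R M) 0 0
    fun P hP _ _ => IsAssociatedPrime.isPrime hP).mp hsub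
  let P' : PrimeSpectrum R := ⟨P, hP.isPrime⟩
  have hP' : P' ∈ Module.support R M :=
    Module.mem_support_iff_of_finite.mpr
      (Submodule.annihilator_top (R := R) (M := M) ▸ hP.annihilator_le)
  have hlt : q' < P' := lt_of_le_of_ne hle fun h => hsupp (h ▸ hP')
  have h1 : Order.coheight P' + 1 ≤ Order.coheight q' := Order.coheight_add_one_le hlt
  have h2 : (Order.coheight q' : WithBot ℕ∞) ≤ ringKrullDim R := Order.coheight_le_krullDim q'
  rw [← hMCM.dim_eq_dim_ring, ← hMCM.depth_eq_dim] at h2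
  have h3 := h1.trans ((WithBot.coe_le_coe.mp h2).trans
    (moduleDepth_le_coheight_of_isAssociatedPrime P' hP))
  -- In `ℕ∞`, `c + 1 ≤ c` is absurd only for finite `c`; `R` has finite dimension.
  have h4 : Order.coheight P' ≠ ⊤ := by
    intro h
    have := (Order.coheight_le_krullDim P').trans_lt (ringKrullDim_lt_top (R := R))
    simp [h] at this
  exact absurd h3 (not_le.mpr (ENat.lt_add_one_iff h4 |>.mpr le_rfl))

theorem corollary2p8 (R : Type u) [CommRing R] [IsLocalRing R] [IsNoetherianRing R]
    (hdim : 2 ≤ ringKrullDim R)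
    (M : Type u) [AddCommGroup M] [Module R M] [Module.Finite R M] [Nontrivial M]
    (hMCM : IsMaximalCohenMacaulay R M) (hrigid : IsTorRigid R M)
    (p : PrimeSpectrum R) (hp : p.asIdeal.height = 2) :
    p ∈ Module.support R M := by
  simp [support_eq_univ_of_isTorRigid hMCM hrigid]
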